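/- Fix a real number $d>2$ and put $\lambda=d/2-1$. Let $G$ be a finite multigraph (loops and parallel edges allowed) with real edge weights $\nu_e$ and with three external labels $0,1,z$, each placed on a vertex. Let $G_v$ be the graph obtained from $G$ by adding an extra vertex $v$ and three edges $\{0,v\},\{1,v\},\{z,v\}$ joining $v$ to the vertices labelled $0,1,z$. Call $G$ externally planar if $G_v$ is planar. If $G_v$ is connected and embedded in the sphere, with planar dual $G_v^\star$ (vertices: the faces; for each edge $e$ an edge $e^\star$ joining the faces on the two sides of $e$), then the graph $G^\star$ obtained from $G_v^\star$ by deleting the edges $\{0,v\}^\star,\{1,v\}^\star,\{z,v\}^\star$, with the labels $0,1,z$ placed on the faces in the corners at $v$ between the edges $\{1,v\},\{z,v\}$, between $\{0,v\},\{z,v\}$, and between $\{0,v\},\{1,v\}$, respectively, and with edge weights determined by $\lambda\nu_e+\lambda\nu_{e^\star}=d/2$, is called a dual of $G$ (as is every labelled weighted graph isomorphic to it). Lemma 4.2. Let $G$ be externally planar with $G_v$ connected (for instance, $G$ connected), and let $G^\star$ be a dual of $G$. Then $G^\star$ is externally planar, $(G^\star)_v$ is connected, and $G$ is a dual of $G^\star$.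 Moreover, if $G$ is connected and its labels $0,1,z$ are on three distinct vertices, then the same holds for $G^\star$. -/

import Mathlib

/-!
Finite multigraphs are `Graph α β` from Mathlib (vertex set in `α`, edge set in `β`, loops and
parallel edges allowed). Embeddings of graphs in the sphere are encoded by rotation systems: each
edge is cut into two darts, and the darts leaving a vertex are put into a cyclic order.
-/

namespace FeynmanDual

open Graph

/-- A multigraph is connected if it has a vertex and any two vertices are joined by a walk. -/
def Connected {α β : Type*} (H : Graph α β) : Prop :=
  V(H).Nonempty ∧ ∀ x ∈ V(H), ∀ y ∈ V(H), Relation.ReflTransGen H.Adj x y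

/-- The darts (half-edges, oriented edges) of a multigraph: two for each edge, loops included. -/
abbrev Dart {α β : Type*} (H : Graph α β) : Type _ := E(H) × Bool

/-- The involution exchanging the two darts of each edge. -/
def flip {α β : Type*} (H : Graph α β) : Equiv.Perm (Dart H) :=
  (Equiv.refl E(H)).prodCongr Equiv.boolNot

/-- A rotation system on `H`, i.e. a cellular embedding (up to homeomorphism) of every connected
component of `H` into a closed oriented surface: `tail` tells from which end of its edge a dart
leaves, and `rot` sends a dart to the next dart, in counterclockwise order, leaving the same
vertex. So the cycles of `rot` are exactly the sets of darts leaving a common vertex. -/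
structure RotationSystem {α β : Type*} (H : Graph α β) where
  tail : Dart H → α
  isLink : ∀ e : E(H), H.IsLink e (tail (e, false)) (tail (e, true))
  rot : Equiv.Perm (Dart H)
  tail_eq_iff : ∀ x y : Dart H, tail x = tail y ↔ rot.SameCycle x y

namespace RotationSystem

variable {α β : Type*} {H : Graph α β} (R : RotationSystem H)

/-- Walking along the boundary of a face: go along the dart `x` to its other end, and leave that
vertex by the dart which comes next, in the rotation there, after the reverse of `x`. -/
def facePerm : Equiv.Perm (Dart H) := R.rot * flip H

/-- The faces of the embedding are the cycles of the boundary walk. -/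
def Face : Type _ := Quotient (Equiv.Perm.SameCycle.setoid R.facePerm)

/-- The face on a fixed side of the dart `x`. The two sides of an edge `e` are `face (e, false)`
and `face (e, true)`. The face in the corner between a dart `x` and the next dart `R.rot x` at
the same vertex is `face (R.rot x)`: its boundary enters the vertex along the reverse of `x` and
leaves along `R.rot x`. -/
def face (x : Dart H) : R.Face :=
  Quotient.mk (Equiv.Perm.SameCycle.setoid R.facePerm) x

/-- The vertices that are incident to at least one edge, as cycles of the rotation. -/
def VertexCycle : Type _ := Quotient (Equiv.Perm.SameCycle.setoid R.rot)

/-- The connected components with at least one edge, as orbits of darts. -/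
def Component : Type _ :=
  MulAction.orbitRel.Quotient
    (Subgroup.closure ({R.rot, flip H} : Set (Equiv.Perm (Dart H)))) (Dart H)

/-- For a finite graph: all components are embedded in a sphere, i.e. the embedding has total
genus `0` by Euler's formula `V - E + F = 2 C`. (Isolated vertices, each of which would add `1`
to `V`, `F` and `C`, are left out.) -/
def IsPlanar : Prop :=
  Nat.card R.VertexCycle + Nat.card R.Face = Nat.card E(H) + 2 * Nat.card R.Component

/-- The dual of a (connected, with at least one edge) embedded graph: its vertices are the faces,
and the edge dual to `e`, again denoted by `e`, joins the faces on the two sides of `e`. -/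
def dual : Graph R.Face E(H) where
  vertexSet := Set.univ
  IsLink e F F' := s(F, F') = s(R.face (e, false), R.face (e, true))
  edgeSet := Set.univ
  isLink_symm := by
    intro e _
    exact ⟨fun x y h => by rw [Sym2.eq_swap]; exact h⟩
  eq_or_eq_of_isLink_of_isLink := by
    intro e x y v w h h'
    have h2 := h.trans h'.symm
    rw [Sym2.eq_iff] at h2
    rcases h2 with h2 | h2
    · exact Or.inl h2.1
    · exact Or.inr h2.1
  edge_mem_iff_exists_isLink := by
    intro e
    exact ⟨fun _ => ⟨_, _, rfl⟩, fun _ => Set.mem_univ _⟩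
  left_mem_of_isLink := by
    intro e x y _
    exact Set.mem_univ _

end RotationSystem

/-- A finite multigraph is planar if it has a planar rotation system. -/
def Planar {α β : Type*} (H : Graph α β) : Prop := ∃ R : RotationSystem H, R.IsPlanar

/-- A finite weighted multigraph with three external labels: `ext 0`, `ext 1`, `ext 2` are the
vertices that carry the labels `0`, `1`, `z`. The same vertex may carry several labels; that the
external vertices are distinct is `Function.Injective G.ext`. -/
structure FeynmanGraph (α β : Type*) where
  graph : Graph α β
  vertices_finite : V(graph).Finite
  edges_finite : E(graph).Finite
  ext : Fin 3 → α
  ext_mem : ∀ i, ext i ∈ V(graph)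
  weight : E(graph) → ℝ

namespace FeynmanGraph

variable {α β : Type*} (G : FeynmanGraph α β)

/-- The graph `G_v`: an extra vertex `v = none` is joined to the vertex with the `i`-th label by
the edge `Sum.inr i`, for each of the three labels. -/
def apexGraph : Graph (Option α) (β ⊕ Fin 3) where
  vertexSet := insert none (some '' V(G.graph))
  IsLink e x y :=
    (∃ e₀ a b, e = Sum.inl e₀ ∧ G.graph.IsLink e₀ a b ∧ x = some a ∧ y = some b) ∨
    (∃ i, e = Sum.inr i ∧ s(x, y) = s(none, some (G.ext i)))
  isLink_symm := by
    intro e _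
    refine ⟨fun x y h => ?_⟩
    rcases h with ⟨e₀, a, b, he, hl, hx, hy⟩ | ⟨i, he, hs⟩
    · exact Or.inl ⟨e₀, b, a, he, hl.symm, hy, hx⟩
    · exact Or.inr ⟨i, he, by rw [Sym2.eq_swap]; exact hs⟩
  eq_or_eq_of_isLink_of_isLink := by
    intro e x y v w h h'
    rcases h with ⟨e₀, a, b, he, hl, hx, hy⟩ | ⟨i, he, hs⟩ <;>
      rcases h' with ⟨e₁, a', b', he', hl', hv, hw⟩ | ⟨j, he', hs'⟩
    · obtain rfl : e₀ = e₁ := Sum.inl_injective (he.symm.trans he')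
      subst hx hv hw
      rcases hl.left_eq_or_eq hl' with rfl | rfl
      · exact Or.inl rfl
      · exact Or.inr rfl
    · exact absurd (he.symm.trans he') (by simp)
    · exact absurd (he.symm.trans he') (by simp)
    · obtain rfl : i = j := Sum.inr_injective (he.symm.trans he')
      have h2 := hs.trans hs'.symm
      rw [Sym2.eq_iff] at h2
      rcases h2 with h2 | h2
      · exact Or.inl h2.1
      · exact Or.inr h2.1
  left_mem_of_isLink := by
    intro e x y h
    rcases h with ⟨e₀, a, b, he, hl, hx, hy⟩ | ⟨i, he, hs⟩
    · exact Or.inr ⟨a, hl.left_mem, hx.symm⟩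
    · rw [Sym2.eq_iff] at hs
      rcases hs with hs | hs
      · exact Or.inl hs.1
      · exact Or.inr ⟨G.ext i, G.ext_mem i, hs.1.symm⟩

/-- An edge of `G`, as an edge of `G_v`. -/
def innerEdge (e : E(G.graph)) : E(G.apexGraph) :=
  ⟨Sum.inl e.1, by
    obtain ⟨a, b, h⟩ := G.graph.exists_isLink_of_mem_edgeSet e.2
    exact ⟨some a, some b, Or.inl ⟨e.1, a, b, rfl, h, rfl, rfl⟩⟩⟩

/-- The edge of `G_v` from the extra vertex to the `i`-th external vertex. -/
def apexEdge (i : Fin 3) : E(G.apexGraph) :=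
  ⟨Sum.inr i, ⟨none, some (G.ext i), Or.inr ⟨i, rfl, rfl⟩⟩⟩

/-- `G` is externally planar if `G_v` is planar. -/
def ExternallyPlanar : Prop := Planar G.apexGraph

/-- `G'` is (isomorphic to) a planar dual of `G` in dimension `d = 2 * lam + 2`, for `G_v`
connected: for some planar embedding of `G_v`, the graph `G'` is the dual of `G_v` minus the duals
of the three edges at the extra vertex `v`, that is, keeping the duals of the edges of `G` only.
At `v`, the face in the corner between the edges to the `j`-th and to the `k`-th external vertex
carries the remaining label `i`. The weights satisfy `lam * ν_e + lam * ν_e⋆ = d / 2`. -/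
def IsDual {α' β' : Type*} (d : ℝ) (G : FeynmanGraph α β) (G' : FeynmanGraph α' β') : Prop :=
  ∃ R : RotationSystem G.apexGraph, R.IsPlanar ∧
    ∃ (f : R.Face ≃ V(G'.graph)) (ε : E(G.graph) ≃ E(G'.graph)),
      (∀ e F F', R.dual.IsLink (G.innerEdge e) F F' ↔ G'.graph.IsLink (ε e) (f F) (f F')) ∧
      (∀ (i : Fin 3) (x : Dart G.apexGraph), R.tail x = none →
        x.1 ≠ G.apexEdge i → (R.rot x).1 ≠ G.apexEdge i →
        (f (R.face (R.rot x)) : α') = G'.ext i) ∧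
      (∀ e, (d - 2) / 2 * G.weight e + (d - 2) / 2 * G'.weight (ε e) = d / 2)

end FeynmanGraph

end FeynmanDual

/-! In the planar dual of `G_v` the star at `v` becomes a triangle around one face, and deleting
this triangle leaves `G'`. Putting a new vertex inside the triangle and joining it to the three
corners embeds `G'_v`: a triangle is replaced by a star.

This is done on darts. With `ρ` the rotation, `φ` the flip and `A` the set of darts leaving `v`, the
edges of `G'_v` are identified with those of `G_v`. The new rotation `starTriangle` is `ρ⁻¹` on `A`
and, off `A`, the face walk `ρ * φ` with the elements of `A` skipped. Its cycles are the old faces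
and `A`; conversely the cycles of `ρ` are `A` and the faces of the new map. Thus `V' = F + 1` and `V
= F' + 1`, while the number of edges and connectedness persist, so Euler's formula carries over. The
same correspondence exhibits `G` as a dual of `G'`.

For the last claim, connectedness of `G'` comes from walking around an external vertex: as it
carries a single label, the walk crosses only edges of `G` and links the two sides of its edge to
`v`. Distinctness of the labels of `G'` is a Jordan curve argument (`exists_potential`): if an edge
at `v` had the same face on both sides, it would be a bridge, but a path in `G` bypasses it. -/

namespace FeynmanDual

open Graph

/-! ### Cycles of permutations and the triangle-star replacement -/

section Permutations

variable {D : Type*}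

/-- The permutations `ρ` and `φ` together generate a transitive action. -/
def JointlyTransitive (ρ φ : Equiv.Perm D) : Prop :=
  ∀ r : Setoid D, (∀ x, r x (ρ x)) → (∀ x, r x (φ x)) → ∀ x y, r x y

theorem rel_of_sameCycle [Finite D] {σ : Equiv.Perm D} (r : Setoid D) (h : ∀ x, r x (σ x))
    {x y : D} (hxy : σ.SameCycle x y) : r x y := by
  obtain ⟨n, -, -, rfl⟩ := hxy.exists_pow_eq'
  clear hxy
  induction n with
  | zero => exact r.refl _
  | succ n ih =>
    rw [pow_succ', Equiv.Perm.mul_apply]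
    exact r.trans ih (h _)

/-- If `τ` is obtained from `σ` by skipping the elements of `A`, of which no two are consecutive,
then the cycles of `σ` and `τ` agree outside `A`. -/
theorem sameCycle_skip_iff [Finite D] {σ τ : Equiv.Perm D} {A : Set D}
    (h₁ : ∀ x ∉ A, σ x ∉ A → τ x = σ x)
    (h₂ : ∀ x ∉ A, σ x ∈ A → σ (σ x) ∉ A ∧ τ x = σ (σ x))
    {x y : D} (hx : x ∉ A) (hy : y ∉ A) : τ.SameCycle x y ↔ σ.SameCycle x y := by
  constructor
  · intro h
    obtain ⟨n, -, -, rfl⟩ := h.exists_pow_eq'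
    clear h hy
    induction n generalizing x with
    | zero => exact Equiv.Perm.SameCycle.refl _ _
    | succ n ih =>
      rw [pow_succ, Equiv.Perm.mul_apply]
      by_cases hσ : σ x ∈ A
      · obtain ⟨h3, h4⟩ := h₂ x hx hσ
        have h5 : σ.SameCycle x (τ x) := by
          rw [h4]
          exact (Equiv.Perm.sameCycle_apply_right.2 (Equiv.Perm.sameCycle_apply_right.2
            (Equiv.Perm.SameCycle.refl _ _)))
        exact h5.trans (ih (h4 ▸ h3))
      · have h4 := h₁ x hx hσ
        have h5 : σ.SameCycle x (τ x) := by
          rw [h4]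
          exact Equiv.Perm.sameCycle_apply_right.2 (Equiv.Perm.SameCycle.refl _ _)
        exact h5.trans (ih (h4 ▸ hσ))
  · intro h
    obtain ⟨n, -, -, rfl⟩ := h.exists_pow_eq'
    clear h
    induction n using Nat.strong_induction_on generalizing x with
    | _ n ih =>
      rcases n with _ | n
      · exact Equiv.Perm.SameCycle.refl _ _
      · by_cases hσ : σ x ∈ A
        · obtain ⟨h3, h4⟩ := h₂ x hx hσ
          rcases n with _ | n
          · exact absurd (by simpa using hσ) hy
          · have h6 : (σ ^ (n + 1 + 1)) x = (σ ^ n) (σ (σ x)) := by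
              rw [pow_succ, pow_succ]; rfl
            rw [h6] at hy ⊢
            have := ih n (by omega) h3 hy
            rw [← h4] at this
            exact Equiv.Perm.sameCycle_apply_left.1 (h4 ▸ this)
        · have h4 := h₁ x hx hσ
          have h6 : (σ ^ (n + 1)) x = (σ ^ n) (σ x) := by
            rw [pow_succ]; rfl
          rw [h6] at hy ⊢
          have := ih n (by omega) hσ hy
          exact Equiv.Perm.sameCycle_apply_left.1 (h4 ▸ this)

/-- Every cycle of `σ` leaves `A`, so it is represented outside `A`, where the two cycle relations
agree. The only further cycle of `τ` is `A` itself. -/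
theorem card_cycles_eq_add_one [Finite D] {σ τ : Equiv.Perm D} {A : Set D}
    (hτ : ∀ x, τ x ∈ A ↔ x ∈ A) (hne : A.Nonempty)
    (hA : ∀ x ∈ A, ∀ y ∈ A, τ.SameCycle x y) (hσ : ∀ x ∈ A, σ x ∉ A)
    (h : ∀ x ∉ A, ∀ y ∉ A, (τ.SameCycle x y ↔ σ.SameCycle x y)) :
    Nat.card (Quotient (Equiv.Perm.SameCycle.setoid τ)) =
      Nat.card (Quotient (Equiv.Perm.SameCycle.setoid σ)) + 1 := by
  obtain ⟨a, ha⟩ := hne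
  have hrep : ∀ q : Quotient (Equiv.Perm.SameCycle.setoid σ), ∃ x ∉ A, Quotient.mk _ x = q := by
    intro q
    induction q using Quotient.inductionOn with
    | _ x =>
      by_cases hx : x ∈ A
      · exact ⟨σ x, hσ x hx, Quotient.sound
          (Equiv.Perm.sameCycle_apply_left.2 (Equiv.Perm.SameCycle.refl _ _))⟩
      · exact ⟨x, hx, rfl⟩
  choose rep hrepA hrep using hrep
  have hmem : ∀ x y, τ.SameCycle x y → (x ∈ A ↔ y ∈ A) := by
    intro x y hxy
    let r : Setoid D := ⟨fun x y => x ∈ A ↔ y ∈ A,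
      ⟨fun _ => Iff.rfl, fun h => h.symm, fun h h' => h.trans h'⟩⟩
    exact rel_of_sameCycle r (fun x => (hτ x).symm) hxy
  let g : Option (Quotient (Equiv.Perm.SameCycle.setoid σ)) →
      Quotient (Equiv.Perm.SameCycle.setoid τ) :=
    fun o => Quotient.mk _ (o.elim a rep)
  have hg : Function.Bijective g := by
    constructor
    · rintro (_ | p) (_ | q) hpq
      · rfl
      · exact absurd ((hmem _ _ (Quotient.exact hpq)).1 ha) (hrepA q)
      · exact absurd ((hmem _ _ (Quotient.exact hpq)).2 ha) (hrepA p)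
      · have h1 : τ.SameCycle (rep p) (rep q) := Quotient.exact hpq
        rw [h _ (hrepA p) _ (hrepA q)] at h1
        rw [← hrep p, ← hrep q]
        exact congrArg some (Quotient.sound h1)
    · intro q
      induction q using Quotient.inductionOn with
      | _ x =>
        by_cases hx : x ∈ A
        · exact ⟨none, Quotient.sound (hA a ha x hx)⟩
        · refine ⟨some (Quotient.mk _ x), Quotient.sound ?_⟩
          exact (h _ (hrepA _) _ hx).2 (Quotient.exact (hrep (Quotient.mk _ x)))
  rw [← Nat.card_eq_of_bijective g hg, Finite.card_option]

theorem sameCycle_permCongr_iff {D' : Type*} (δ : D ≃ D') (σ : Equiv.Perm D) {x y : D} :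
    (δ.permCongr σ).SameCycle (δ x) (δ y) ↔ σ.SameCycle x y := by
  have key : ∀ n : ℤ, (δ.permCongr σ) ^ n = δ.permCongr (σ ^ n) := fun n =>
    (map_zpow δ.permCongrHom σ n).symm
  unfold Equiv.Perm.SameCycle
  simp [key, Equiv.permCongr_apply]

theorem card_cycles_permCongr {D' : Type*} (δ : D ≃ D') (σ : Equiv.Perm D) :
    Nat.card (Quotient (Equiv.Perm.SameCycle.setoid (δ.permCongr σ))) =
      Nat.card (Quotient (Equiv.Perm.SameCycle.setoid σ)) :=
  (Nat.card_congr (Quotient.congr δ fun _ _ => (sameCycle_permCongr_iff δ σ).symm)).symm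

theorem JointlyTransitive.permCongr {D' : Type*} {ρ φ : Equiv.Perm D}
    (h : JointlyTransitive ρ φ) (δ : D ≃ D') :
    JointlyTransitive (δ.permCongr ρ) (δ.permCongr φ) := by
  intro r hρ hφ x y
  have := h (r.comap δ) (fun x => by simpa [Setoid.comap_rel] using hρ (δ x))
    (fun x => by simpa [Setoid.comap_rel] using hφ (δ x)) (δ.symm x) (δ.symm y)
  simpa [Setoid.comap_rel] using this

/-- `A` is a union of cycles of `ρ` (a set of vertices) without an edge, i.e. a cycle of the
involution `φ`, inside. -/
structure IsIndependent (ρ φ : Equiv.Perm D) (A : Set D) : Prop where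
  rot_mem : ∀ x, ρ x ∈ A ↔ x ∈ A
  flip_flip : ∀ x, φ (φ x) = x
  flip_notMem : ∀ x ∈ A, φ x ∉ A

namespace IsIndependent

variable {ρ φ : Equiv.Perm D} {A : Set D}

theorem rot_symm_mem (h : IsIndependent ρ φ A) (x : D) : ρ.symm x ∈ A ↔ x ∈ A := by
  rw [← h.rot_mem, Equiv.apply_symm_apply]

-- Off `A` the formula is the first return of `ρ * φ` to the complement of `A`: `ρ (φ x)` lies in
-- `A` exactly if `φ x` does, and then one more step leaves `A`. On `A` the rotation is reversed;
-- this is what makes the construction invert itself on faces, see `sameCycle_starTriangle_mul_iff`.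
open Classical in
theorem starTriangle_injective (h : IsIndependent ρ φ A) : Function.Injective (fun x : D =>
    if x ∈ A then ρ.symm x else if φ x ∈ A then ρ (φ (ρ (φ x))) else ρ (φ x)) := by
  intro x y hxy
  have h1 := h.rot_mem
  have h2 := h.rot_symm_mem
  have h3 := h.flip_flip
  have h4 := h.flip_notMem
  dsimp only at hxy
  split_ifs at hxy with hx hx' hy' hy hy' <;>
    grind [ρ.injective, φ.injective, ρ.symm.injective, Function.Injective]

variable (h : IsIndependent ρ φ A)

open Classical in
/-- The rotation of the dual map, in which a triangle around each vertex in `A` (three darts at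
the vertex) is replaced by a star. -/
noncomputable def starTriangle [Finite D] : Equiv.Perm D :=
  Equiv.ofBijective _ (Finite.injective_iff_bijective.1 h.starTriangle_injective)

variable [Finite D]

theorem starTriangle_of_mem {x : D} (hx : x ∈ A) : h.starTriangle x = ρ.symm x := by
  simp [starTriangle, hx]

theorem starTriangle_of_flip_mem {x : D} (hx : φ x ∈ A) :
    h.starTriangle x = ρ (φ (ρ (φ x))) := by
  have : x ∉ A := fun h' => h.flip_notMem x h' hx
  simp [starTriangle, hx, this]

theorem starTriangle_of_notMem {x : D} (hx : x ∉ A) (hx' : φ x ∉ A) :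
    h.starTriangle x = ρ (φ x) := by
  simp [starTriangle, hx, hx']

theorem starTriangle_mem (x : D) : h.starTriangle x ∈ A ↔ x ∈ A := by
  by_cases hx : x ∈ A
  · simp [h.starTriangle_of_mem hx, h.rot_symm_mem]
  by_cases hx' : φ x ∈ A
  · have := h.flip_notMem _ ((h.rot_mem _).2 hx')
    simp [h.starTriangle_of_flip_mem hx', h.rot_mem, hx, this]
  · simp [h.starTriangle_of_notMem hx hx', h.rot_mem, hx, hx']

theorem sameCycle_starTriangle_iff {x y : D} (hx : x ∉ A) (hy : y ∉ A) :
    h.starTriangle.SameCycle x y ↔ (ρ * φ).SameCycle x y := by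
  refine sameCycle_skip_iff (A := A) ?_ ?_ hx hy
  · intro x hx hσ
    rw [Equiv.Perm.mul_apply, h.rot_mem] at hσ
    exact h.starTriangle_of_notMem hx hσ
  · intro x hx hσ
    refine ⟨?_, ?_⟩
    · simp only [Equiv.Perm.mul_apply, h.rot_mem] at hσ ⊢
      exact h.flip_notMem _ ((h.rot_mem _).2 hσ)
    · simp only [Equiv.Perm.mul_apply, h.rot_mem] at hσ ⊢
      exact h.starTriangle_of_flip_mem hσ

theorem starTriangle_flip_mem_iff (x : D) : (h.starTriangle * φ) x ∈ A ↔ φ x ∈ A := by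
  rw [Equiv.Perm.mul_apply, h.starTriangle_mem]

/-- The new face walk is `ρ` with detours into `A`: on a detour the step `ρ.symm` on `A` cancels the
inner `ρ` in `ρ (φ (ρ (φ _)))`, and what remains is `ρ x`. -/
theorem sameCycle_starTriangle_mul_iff {x y : D} (hx : x ∉ A) (hy : y ∉ A) :
    ρ.SameCycle x y ↔ (h.starTriangle * φ).SameCycle x y := by
  refine sameCycle_skip_iff (A := A) ?_ ?_ hx hy
  · intro x hx hσ
    rw [h.starTriangle_flip_mem_iff] at hσ
    rw [Equiv.Perm.mul_apply, h.starTriangle_of_notMem hσ (by rwa [h.flip_flip]), h.flip_flip]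
  · intro x hx hσ
    rw [h.starTriangle_flip_mem_iff] at hσ ⊢
    refine ⟨?_, ?_⟩
    · rw [Equiv.Perm.mul_apply, h.starTriangle_of_mem hσ]
      exact h.flip_notMem _ ((h.rot_symm_mem _).2 hσ)
    · have h1 : φ (φ (ρ.symm (φ x))) ∈ A := by rwa [h.flip_flip, h.rot_symm_mem]
      simp only [Equiv.Perm.mul_apply]
      rw [h.starTriangle_of_mem hσ, h.starTriangle_of_flip_mem h1]
      simp [h.flip_flip]

theorem sameCycle_starTriangle_of_mem (hA : ∀ x ∈ A, ∀ y ∈ A, ρ.SameCycle x y)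
    {x y : D} (hx : x ∈ A) (hy : y ∈ A) : h.starTriangle.SameCycle x y := by
  obtain ⟨n, -, -, rfl⟩ := (hA y hy x hx).exists_pow_eq'
  clear hx
  induction n with
  | zero => exact Equiv.Perm.SameCycle.refl _ _
  | succ n ih =>
    have h1 : (ρ ^ (n + 1)) y ∈ A := by
      clear ih
      induction n + 1 with
      | zero => exact hy
      | succ n ih =>
        rw [pow_succ', Equiv.Perm.mul_apply, h.rot_mem]
        exact ih
    have h2 := h.starTriangle_of_mem h1
    rw [pow_succ', Equiv.Perm.mul_apply, Equiv.symm_apply_apply] at h2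
    rw [← Equiv.Perm.sameCycle_apply_left, pow_succ', Equiv.Perm.mul_apply, h2]
    exact ih

theorem card_cycles_starTriangle (hne : A.Nonempty)
    (hA : ∀ x ∈ A, ∀ y ∈ A, ρ.SameCycle x y) :
    Nat.card (Quotient (Equiv.Perm.SameCycle.setoid h.starTriangle)) =
      Nat.card (Quotient (Equiv.Perm.SameCycle.setoid (ρ * φ))) + 1 := by
  refine card_cycles_eq_add_one h.starTriangle_mem hne
    (fun x hx y hy => h.sameCycle_starTriangle_of_mem hA hx hy) ?_
    fun x hx y hy => h.sameCycle_starTriangle_iff hx hy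
  intro x hx
  rw [Equiv.Perm.mul_apply, h.rot_mem]
  exact h.flip_notMem x hx

theorem card_cycles_eq_starTriangle_mul (hne : A.Nonempty)
    (hA : ∀ x ∈ A, ∀ y ∈ A, ρ.SameCycle x y) :
    Nat.card (Quotient (Equiv.Perm.SameCycle.setoid ρ)) =
      Nat.card (Quotient (Equiv.Perm.SameCycle.setoid (h.starTriangle * φ))) + 1 := by
  refine card_cycles_eq_add_one h.rot_mem hne hA ?_
    fun x hx y hy => h.sameCycle_starTriangle_mul_iff hx hy
  intro x hx
  rw [h.starTriangle_flip_mem_iff]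
  exact h.flip_notMem x hx

/-- A step of `ρ` is recovered from the new data: inside `A` it stays in one cycle of the new
rotation, outside `A` in one cycle of the new face walk. -/
theorem jointlyTransitive_starTriangle (hA : ∀ x ∈ A, ∀ y ∈ A, ρ.SameCycle x y)
    (ht : JointlyTransitive ρ φ) : JointlyTransitive h.starTriangle φ := by
  intro r hρ hφ
  refine ht r (fun x => ?_) hφ
  by_cases hx : x ∈ A
  · exact rel_of_sameCycle r hρ
      (h.sameCycle_starTriangle_of_mem hA hx ((h.rot_mem x).2 hx))
  · refine rel_of_sameCycle r (σ := h.starTriangle * φ) (fun y => r.trans (hφ y) (hρ _)) ?_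
    rw [← h.sameCycle_starTriangle_mul_iff hx (by rwa [h.rot_mem])]
    exact Equiv.Perm.sameCycle_apply_right.2 (Equiv.Perm.SameCycle.refl _ _)

end IsIndependent

end Permutations

/-! ### Rotation systems: connectedness and faces -/

section RotationSystems

variable {α β : Type*} {H : Graph α β}

@[simp]
theorem flip_mk (e : E(H)) (b : Bool) : flip H (e, b) = (e, !b) := rfl

@[simp]
theorem flip_fst (x : Dart H) : (flip H x).1 = x.1 := rfl

@[simp]
theorem flip_flip (x : Dart H) : flip H (flip H x) = x := by
  obtain ⟨e, b⟩ := x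
  simp

theorem eq_or_eq_flip {x y : Dart H} (h : x.1 = y.1) : x = y ∨ x = flip H y := by
  obtain ⟨e, b⟩ := x
  obtain ⟨e', b'⟩ := y
  obtain rfl : e = e' := h
  cases b <;> cases b' <;> simp

namespace RotationSystem

variable (R : RotationSystem H)

theorem isLink_dart (x : Dart H) : H.IsLink x.1 (R.tail x) (R.tail (flip H x)) := by
  obtain ⟨e, _ | _⟩ := x
  · exact R.isLink e
  · exact (R.isLink e).symm

theorem tail_rot (x : Dart H) : R.tail (R.rot x) = R.tail x := by
  rw [R.tail_eq_iff, Equiv.Perm.sameCycle_apply_left]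

theorem exists_tail_eq {e : β} {u w : α} (h : H.IsLink e u w) :
    ∃ x : Dart H, x.1 = e ∧ R.tail x = u ∧ R.tail (flip H x) = w := by
  let e' : E(H) := ⟨e, h.edge_mem⟩
  rcases (R.isLink e').eq_and_eq_or_eq_and_eq h with ⟨h1, h2⟩ | ⟨h1, h2⟩
  · exact ⟨(e', false), rfl, h1, h2⟩
  · exact ⟨(e', true), rfl, h2, h1⟩

theorem face_eq_iff {x y : Dart H} : R.face x = R.face y ↔ (R.rot * flip H).SameCycle x y :=
  ⟨fun h => Quotient.exact h, fun h => Quotient.sound h⟩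

theorem face_surjective : Function.Surjective R.face := Quotient.mk_surjective

theorem face_rot_flip (x : Dart H) : R.face (R.rot (flip H x)) = R.face x :=
  R.face_eq_iff.2 (Equiv.Perm.sameCycle_apply_left.2 (Equiv.Perm.SameCycle.refl _ _))

theorem face_flip (x : Dart H) : R.face (flip H x) = R.face (R.rot x) := by
  rw [← R.face_rot_flip (flip H x), flip_flip]

theorem jointlyTransitive_of_connected [Finite (Dart H)] (hc : Connected H) :
    JointlyTransitive R.rot (flip H) := by
  intro r hrot hflip x y
  have htail : ∀ {x y : Dart H}, R.tail x = R.tail y → r x y := fun h =>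
    rel_of_sameCycle r hrot ((R.tail_eq_iff _ _).1 h)
  suffices h : ∀ w, Relation.ReflTransGen H.Adj (R.tail x) w → ∀ y, R.tail y = w → r x y from
    h _ (hc.2 _ (R.isLink_dart x).left_mem _ (R.isLink_dart y).left_mem) y rfl
  intro w hw
  induction hw with
  | refl => exact fun y hy => htail hy.symm
  | tail _ hadj ih =>
    intro y hy
    obtain ⟨e, he⟩ := hadj
    obtain ⟨z, -, hz, hz'⟩ := R.exists_tail_eq he
    exact r.trans (r.trans (ih z hz) (hflip z)) (htail (hz'.trans hy.symm))

/-- The hypothesis `htail` excludes isolated vertices, which are invisible to darts. -/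
theorem connected_of_jointlyTransitive (h : JointlyTransitive R.rot (flip H))
    (hne : V(H).Nonempty) (htail : ∀ w ∈ V(H), ∃ x, R.tail x = w) : Connected H := by
  refine ⟨hne, fun u hu w hw => ?_⟩
  obtain ⟨x, rfl⟩ := htail u hu
  obtain ⟨y, rfl⟩ := htail w hw
  have : Std.Symm H.Adj := ⟨fun _ _ h => h.symm⟩
  have hsymm := Relation.ReflTransGen.stdSymm (r := H.Adj)
  let r : Setoid (Dart H) := ⟨fun x y => Relation.ReflTransGen H.Adj (R.tail x) (R.tail y),
    ⟨fun _ => .refl, fun h => hsymm.symm _ _ h, fun h h' => h.trans h'⟩⟩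
  refine h r (fun x => ?_) (fun x => ?_) x y
  · change Relation.ReflTransGen H.Adj (R.tail x) (R.tail (R.rot x))
    rw [R.tail_rot]
  · exact .single (R.isLink_dart x).adj

theorem card_component (h : JointlyTransitive R.rot (flip H)) [Nonempty (Dart H)] :
    Nat.card R.Component = 1 := by
  have hsub : Subsingleton R.Component := by
    constructor
    intro p q
    induction p using Quotient.inductionOn with
    | _ x =>
      induction q using Quotient.inductionOn with
      | _ y =>
        apply Quotient.sound
        refine h _ (fun x => ?_) (fun x => ?_) x y
        · apply Setoid.symm'
          exact ⟨⟨R.rot, Subgroup.subset_closure (by simp)⟩, rfl⟩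
        · apply Setoid.symm'
          exact ⟨⟨flip H, Subgroup.subset_closure (by simp)⟩, rfl⟩
  have hne : Nonempty R.Component := ⟨Quotient.mk _ (Classical.arbitrary (Dart H))⟩
  exact Nat.card_eq_one_iff_unique.2 ⟨hsub, hne⟩

/-! ### Vertex and face gradients on the sphere -/

section Potential

/-- The difference along the edges of a function on `Q`, where `q` is the map from the darts to
their vertices or to their faces. -/
noncomputable def gradient {Q : Type*} (q : Dart H → Q) : (Q → ℝ) →ₗ[ℝ] EuclideanSpace ℝ E(H) where
  toFun p := WithLp.toLp 2 fun e => p (q (e, true)) - p (q (e, false))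
  map_add' p p' := by
    ext e
    simp only [Pi.add_apply, PiLp.add_apply]
    ring
  map_smul' c p := by
    ext e
    simp only [Pi.smul_apply, PiLp.smul_apply, smul_eq_mul, RingHom.id_apply]
    ring

theorem gradient_apply {Q : Type*} (q : Dart H → Q) (p : Q → ℝ) (e : E(H)) :
    gradient q p e = p (q (e, true)) - p (q (e, false)) := rfl

theorem flip_eq_of_gradient {Q : Type*} {q : Dart H → Q} {p : Q → ℝ} {x : Dart H}
    (h : gradient q p x.1 = 0) : p (q (flip H x)) = p (q x) := by
  rw [gradient_apply, sub_eq_zero] at h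
  obtain ⟨e, _ | _⟩ := x
  · exact h
  · exact h.symm

/-- Rank-nullity: by `h`, a form of connectedness, the kernel consists of the constants. -/
theorem finrank_range_gradient [Nonempty (Dart H)] {Q : Type*} [Fintype Q] {q : Dart H → Q}
    (hq : Function.Surjective q)
    (h : ∀ p : Q → ℝ, (∀ x, p (q (flip H x)) = p (q x)) → ∀ x y, p (q x) = p (q y)) :
    Module.finrank ℝ (LinearMap.range (gradient q)) + 1 = Nat.card Q := by
  have hker : LinearMap.ker (gradient q) = Submodule.span ℝ {fun _ => (1 : ℝ)} := by
    ext p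
    rw [LinearMap.mem_ker, Submodule.mem_span_singleton]
    constructor
    · intro hp
      have hc := h p fun x => flip_eq_of_gradient (by rw [hp]; rfl)
      refine ⟨p (q (Classical.arbitrary _)), ?_⟩
      ext v
      obtain ⟨x, rfl⟩ := hq v
      simpa using hc _ x
    · rintro ⟨c, rfl⟩
      ext e
      simp [gradient_apply]
  have hne : (fun _ : Q => (1 : ℝ)) ≠ 0 := fun h0 =>
    one_ne_zero (congrFun h0 (q (Classical.arbitrary _)))
  have := LinearMap.finrank_range_add_finrank_ker (gradient q)
  rwa [hker, finrank_span_singleton hne, Module.finrank_fintype_fun_eq_card,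
    ← Nat.card_eq_fintype_card] at this

variable [Fintype E(H)]

/-- On a connected graph embedded in the sphere, a unit flow along an edge with the same face on
both sides is a gradient. -/
theorem exists_potential [Nonempty (Dart H)] (ht : JointlyTransitive R.rot (flip H))
    (hR : R.IsPlanar) {x₀ : Dart H} (hx₀ : R.face x₀ = R.face (flip H x₀)) :
    ∃ p : Dart H → ℝ, (∀ x y, R.tail x = R.tail y → p x = p y) ∧
      (∀ x, x.1 ≠ x₀.1 → p (flip H x) = p x) ∧ p (flip H x₀) ≠ p x₀ := by
  classical
  have : Finite R.VertexCycle := Quotient.finite _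
  have : Finite R.Face := Quotient.finite _
  have := Fintype.ofFinite R.VertexCycle
  have := Fintype.ofFinite R.Face
  let q : Dart H → R.VertexCycle := Quotient.mk _
  have hq : ∀ x, q (R.rot x) = q x := fun x =>
    Quotient.sound (Equiv.Perm.sameCycle_apply_left.2 (Equiv.Perm.SameCycle.refl _ _))
  have hV : Module.finrank ℝ (LinearMap.range (gradient q)) + 1 = Nat.card R.VertexCycle :=
    finrank_range_gradient Quotient.mk_surjective fun p hp =>
      ht (Setoid.ker fun x => p (q x)) (fun x => congrArg p (hq x).symm) fun x => (hp x).symm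
  have hF : Module.finrank ℝ (LinearMap.range (gradient R.face)) + 1 = Nat.card R.Face :=
    finrank_range_gradient R.face_surjective fun p hp =>
      ht (Setoid.ker fun x => p (R.face x))
        (fun x => ((hp x).symm.trans (congrArg p (R.face_flip x)) :)) fun x => (hp x).symm
  -- Summation by parts: `flip H x` and `R.rot x` lie on the same face, and `R.rot` permutes the
  -- darts at each vertex.
  have horth : ∀ p h, inner ℝ (gradient R.face h) (gradient q p) = 0 := by
    intro p h
    have h1 : ∑ x : Dart H, p (q x) * h (R.face (flip H x)) =
        ∑ x : Dart H, p (q x) * h (R.face x) := by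
      rw [← Equiv.sum_comp R.rot fun x : Dart H => p (q x) * h (R.face x)]
      exact Finset.sum_congr rfl fun x _ => by rw [hq, R.face_flip]
    simp only [Fintype.sum_prod_type, Fintype.sum_bool, flip_mk, Bool.not_true,
      Bool.not_false] at h1
    rw [← sub_eq_zero, ← Finset.sum_sub_distrib] at h1
    rw [PiLp.inner_apply, ← neg_eq_zero, ← Finset.sum_neg_distrib, ← h1]
    refine Finset.sum_congr rfl fun e _ => ?_
    simp only [gradient_apply, inner, RCLike.re_to_real, star_trivial]
    ring
  have hle : LinearMap.range (gradient q) ≤ (LinearMap.range (gradient R.face))ᗮ := by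
    rintro _ ⟨p, rfl⟩
    rw [Submodule.mem_orthogonal]
    rintro _ ⟨h, rfl⟩
    exact horth p h
  have hE := (LinearMap.range (gradient R.face)).finrank_add_finrank_orthogonal
  have hplanar : Nat.card R.VertexCycle + Nat.card R.Face = Nat.card E(H) + 2 * 1 := by
    rw [← R.card_component ht]
    exact hR
  rw [finrank_euclideanSpace, ← Nat.card_eq_fintype_card] at hE
  -- The dimensions are `V - 1` and `F - 1`; by Euler's formula they add up to `E`, so the
  -- orthogonal spaces are complements.
  have heq := Submodule.eq_of_le_of_finrank_eq hle (by omega)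
  -- Face gradients vanish on an edge with equal sides, so the unit flow along it is orthogonal to
  -- all of them.
  have hmem : EuclideanSpace.single x₀.1 (1 : ℝ) ∈ LinearMap.range (gradient q) := by
    rw [heq, Submodule.mem_orthogonal]
    rintro _ ⟨h, rfl⟩
    have : gradient R.face h x₀.1 = 0 := by
      rw [gradient_apply, sub_eq_zero]
      obtain ⟨e, _ | _⟩ := x₀
      · exact congrArg h hx₀.symm
      · exact congrArg h hx₀
    simp [EuclideanSpace.inner_single_right, this]
  obtain ⟨p, hp⟩ := hmem
  refine ⟨fun x => p (q x), fun x y hxy => ?_, fun x hx => ?_, fun h => ?_⟩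
  · exact congrArg p (Quotient.sound ((R.tail_eq_iff _ _).1 hxy))
  · exact flip_eq_of_gradient (by rw [hp]; simp [hx])
  · have h1 : gradient q p x₀.1 = 1 := by rw [hp]; simp
    rw [gradient_apply] at h1
    obtain ⟨e, _ | _⟩ := x₀
    · simp only [flip_mk, Bool.not_false] at h
      simp only at h1
      linarith
    · simp only [flip_mk, Bool.not_true] at h
      simp only at h1
      linarith

end Potential

end RotationSystem

end RotationSystems

/-- A permutation of three labels without fixed points is a 3-cycle. -/
theorem apply_eq_of_ne {τ : Equiv.Perm (Fin 3)} (hτ : ∀ i, τ i ≠ i) {i j : Fin 3}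
    (h₁ : i ≠ j) (h₂ : i ≠ τ j) : τ i = j := by
  have h3 := hτ i
  have h4 := hτ j
  have h5 : τ i ≠ τ j := fun h => h₁ (τ.injective h)
  omega

theorem apply_apply_ne {τ : Equiv.Perm (Fin 3)} (hτ : ∀ i, τ i ≠ i) (i : Fin 3) : τ (τ i) ≠ i := by
  revert τ i
  decide

/-! ### The darts at the extra vertex -/

namespace FeynmanGraph

variable {α β : Type*} (G : FeynmanGraph α β)

theorem apexGraph_isLink_inl {e : β} {x y : Option α} :
    G.apexGraph.IsLink (Sum.inl e) x y ↔ ∃ a b, G.graph.IsLink e a b ∧ x = some a ∧ y = some b := by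
  constructor
  · rintro (⟨e₀, a, b, he, h⟩ | ⟨i, hi, -⟩)
    · obtain rfl := Sum.inl_injective he
      exact ⟨a, b, h⟩
    · exact absurd hi (by simp)
  · rintro ⟨a, b, h⟩
    exact Or.inl ⟨e, a, b, rfl, h⟩

theorem apexGraph_isLink_inr {i : Fin 3} {x y : Option α} :
    G.apexGraph.IsLink (Sum.inr i) x y ↔ s(x, y) = s(none, some (G.ext i)) := by
  constructor
  · rintro (⟨e₀, a, b, he, -⟩ | ⟨j, hj, h⟩)
    · exact absurd he (by simp)
    · obtain rfl := Sum.inr_injective hj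
      exact h
  · exact fun h => Or.inr ⟨i, rfl, h⟩

/-- The edges of `G_v` are the edges of `G` and the three edges at the extra vertex. -/
noncomputable def edgeEquiv : E(G.graph) ⊕ Fin 3 ≃ E(G.apexGraph) :=
  Equiv.ofBijective (Sum.elim G.innerEdge G.apexEdge) <| by
    constructor
    · rintro (e | i) (e' | j) h <;> have h' := congrArg Subtype.val h
      · exact congrArg Sum.inl (Subtype.ext (Sum.inl_injective h'))
      · exact absurd (show (Sum.inl e.1 : β ⊕ Fin 3) = Sum.inr j from h') (by simp)
      · exact absurd (show (Sum.inr i : β ⊕ Fin 3) = Sum.inl e'.1 from h') (by simp)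
      · exact congrArg Sum.inr (Sum.inr_injective h')
    · rintro ⟨e | i, he⟩
      · obtain ⟨x, y, h⟩ := exists_isLink_of_mem_edgeSet he
        obtain ⟨a, b, h, -⟩ := G.apexGraph_isLink_inl.1 h
        exact ⟨Sum.inl ⟨e, h.edge_mem⟩, rfl⟩
      · exact ⟨Sum.inr i, rfl⟩

@[simp]
theorem edgeEquiv_inl (e : E(G.graph)) : G.edgeEquiv (Sum.inl e) = G.innerEdge e := rfl

@[simp]
theorem edgeEquiv_inr (i : Fin 3) : G.edgeEquiv (Sum.inr i) = G.apexEdge i := rfl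

theorem apexEdge_injective : Function.Injective G.apexEdge := fun _ _ h =>
  Sum.inr_injective (G.edgeEquiv.injective h)

theorem finite_edges : Finite E(G.apexGraph) :=
  have : Finite E(G.graph) := G.edges_finite
  Finite.of_equiv _ G.edgeEquiv

instance finite_darts : Finite (Dart G.apexGraph) :=
  have := G.finite_edges
  inferInstance

instance : Nonempty (Dart G.apexGraph) := ⟨(G.apexEdge 0, false)⟩

theorem none_mem : none ∈ V(G.apexGraph) := Set.mem_insert _ _

theorem some_mem_iff {w : α} : some w ∈ V(G.apexGraph) ↔ w ∈ V(G.graph) := by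
  change some w ∈ insert none (some '' V(G.graph)) ↔ _
  simp

variable {G} (R : RotationSystem G.apexGraph)

theorem exists_tail_innerEdge (x : Dart G.apexGraph) {e : E(G.graph)} (hx : x.1 = G.innerEdge e) :
    ∃ a b, G.graph.IsLink e a b ∧ R.tail x = some a ∧ R.tail (flip _ x) = some b := by
  have := R.isLink_dart x
  rw [hx] at this
  exact G.apexGraph_isLink_inl.1 this

theorem exists_apexDart (i : Fin 3) : ∃ x : Dart G.apexGraph,
    x.1 = G.apexEdge i ∧ R.tail x = none ∧ R.tail (flip _ x) = some (G.ext i) := by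
  obtain ⟨x, hx, h⟩ := R.exists_tail_eq
    (G.apexGraph_isLink_inr.2 (rfl : s(none, some (G.ext i)) = _))
  exact ⟨x, Subtype.ext hx, h⟩

/-- The dart from the extra vertex to the `i`-th external vertex. -/
noncomputable def apexDart (i : Fin 3) : Dart G.apexGraph := (exists_apexDart R i).choose

@[simp]
theorem apexDart_fst (i : Fin 3) : (apexDart R i).1 = G.apexEdge i :=
  (exists_apexDart R i).choose_spec.1

@[simp]
theorem tail_apexDart (i : Fin 3) : R.tail (apexDart R i) = none :=
  (exists_apexDart R i).choose_spec.2.1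

@[simp]
theorem tail_flip_apexDart (i : Fin 3) :
    R.tail (flip _ (apexDart R i)) = some (G.ext i) :=
  (exists_apexDart R i).choose_spec.2.2

theorem apexDart_injective : Function.Injective (apexDart R) := fun i j h =>
  G.apexEdge_injective (by rw [← apexDart_fst R, h, apexDart_fst])

theorem dart_cases {P : Dart G.apexGraph → Prop} (h₁ : ∀ x e, x.1 = G.innerEdge e → P x)
    (h₂ : ∀ i, P (apexDart R i)) (h₃ : ∀ i, P (flip _ (apexDart R i))) (x : Dart G.apexGraph) :
    P x := by
  obtain ⟨e | i, he⟩ := G.edgeEquiv.surjective x.1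
  · exact h₁ x e he.symm
  · rcases eq_or_eq_flip (he.symm.trans (apexDart_fst R i).symm) with rfl | rfl
    · exact h₂ i
    · exact h₃ i

theorem tail_eq_none_iff {x : Dart G.apexGraph} :
    R.tail x = none ↔ ∃ i, x = apexDart R i := by
  constructor
  · refine dart_cases (P := fun x => R.tail x = none → ∃ i, x = apexDart R i) R
      (fun x e hx h => ?_) (fun i _ => ⟨i, rfl⟩) (fun i h => ?_) x
    · obtain ⟨a, b, -, h', -⟩ := exists_tail_innerEdge R x hx
      simp [h'] at h
    · simp at h
  · rintro ⟨i, rfl⟩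
    simp

theorem isIndependent_apex : IsIndependent R.rot (flip _) {x | R.tail x = none} where
  rot_mem x := by simp [R.tail_rot]
  flip_flip := flip_flip
  flip_notMem x hx := by
    obtain ⟨i, rfl⟩ := (tail_eq_none_iff R).1 hx
    simp

theorem sameCycle_of_tail_eq_none :
    ∀ x ∈ {x | R.tail x = none}, ∀ y ∈ {x | R.tail x = none}, R.rot.SameCycle x y :=
  fun _ hx _ hy => (R.tail_eq_iff _ _).1 (hx.trans hy.symm)

theorem apex_nonempty : {x | R.tail x = none}.Nonempty := ⟨apexDart R 0, tail_apexDart R 0⟩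

theorem exists_perm_labels : ∃ τ : Equiv.Perm (Fin 3),
    (∀ i, R.rot (apexDart R i) = apexDart R (τ i)) ∧ ∀ i, τ i ≠ i := by
  have h : ∀ i, ∃ j, R.rot (apexDart R i) = apexDart R j := fun i => by
    rw [← tail_eq_none_iff, R.tail_rot, tail_apexDart]
  choose τ hτ using h
  have hinj : Function.Injective τ := fun i j hij =>
    apexDart_injective R (R.rot.injective (by rw [hτ, hτ, hij]))
  refine ⟨Equiv.ofBijective τ (Finite.injective_iff_bijective.1 hinj), hτ, fun i hi => ?_⟩
  -- The three darts leaving the extra vertex form one cycle, so none of them is fixed.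
  have hfix : Function.IsFixedPt R.rot (apexDart R i) := by
    have := hτ i
    rwa [show τ i = i from hi] at this
  have : ∀ j, i = j := fun j => apexDart_injective R <|
    (sameCycle_of_tail_eq_none R (apexDart R i) (by simp) (apexDart R j) (by simp)).eq_of_left hfix
  exact absurd ((this 0).symm.trans (this 1)) (by simp)

theorem exists_tail_eq_some (hc : Connected G.apexGraph) {w : α} (hw : w ∈ V(G.graph)) :
    ∃ x, R.tail x = some w := by
  have h := hc.2 (some w) (G.some_mem_iff.2 hw) none G.none_mem
  rcases h.cases_head with h | ⟨_, ⟨e, he⟩, -⟩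
  · simp at h
  · obtain ⟨x, -, hx, -⟩ := R.exists_tail_eq he
    exact ⟨x, hx⟩

end FeynmanGraph

/-! ### The embedding of `G'_v` and the duality back to `G` -/

namespace FeynmanGraph

variable {α β α' β' : Type*}

/-- An embedding of `G_v` together with an identification of `G'` with the resulting dual of `G`,
up to weights. The permutation `τ` is the order of the labels around the extra vertex. -/
structure DualEmbedding (G : FeynmanGraph α β) (G' : FeynmanGraph α' β') where
  R : RotationSystem G.apexGraph
  faceEquiv : R.Face ≃ V(G'.graph)
  edgeMap : E(G.graph) ≃ E(G'.graph)
  isLink_iff : ∀ e F F', R.dual.IsLink (G.innerEdge e) F F' ↔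
    G'.graph.IsLink (edgeMap e) (faceEquiv F) (faceEquiv F')
  τ : Equiv.Perm (Fin 3)
  rot_apexDart : ∀ i, R.rot (apexDart R i) = apexDart R (τ i)
  τ_ne : ∀ i, τ i ≠ i
  faceEquiv_apexDart : ∀ i, (faceEquiv (R.face (flip _ (apexDart R i))) : α') = G'.ext (τ.symm i)

namespace DualEmbedding

variable {G : FeynmanGraph α β} {G' : FeynmanGraph α' β'} (D : DualEmbedding G G')

theorem isLink_face (x : Dart G.apexGraph) {e : E(G.graph)} (hx : x.1 = G.innerEdge e) :
    G'.graph.IsLink (D.edgeMap e) (D.faceEquiv (D.R.face x))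
      (D.faceEquiv (D.R.face (flip _ x))) := by
  rw [← D.isLink_iff]
  obtain ⟨e', _ | _⟩ := x <;> obtain rfl : e' = _ := hx
  · exact rfl
  · exact Sym2.eq_swap

/-- The correspondence between the edges of `G_v` and those of `G'_v`: the edge of the dual at
the `i`-th external vertex corresponds to the edge before the corner with the label `i`. -/
noncomputable def apexEdgeMap : E(G.apexGraph) ≃ E(G'.apexGraph) :=
  G.edgeEquiv.symm.trans ((D.edgeMap.sumCongr D.τ.symm).trans G'.edgeEquiv)

@[simp]
theorem apexEdgeMap_innerEdge (e : E(G.graph)) :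
    D.apexEdgeMap (G.innerEdge e) = G'.innerEdge (D.edgeMap e) := by
  simp [apexEdgeMap, ← edgeEquiv_inl]

@[simp]
theorem apexEdgeMap_apexEdge (i : Fin 3) :
    D.apexEdgeMap (G.apexEdge i) = G'.apexEdge (D.τ.symm i) := by
  simp [apexEdgeMap, ← edgeEquiv_inr]

noncomputable def dartMap : Dart G.apexGraph ≃ Dart G'.apexGraph :=
  D.apexEdgeMap.prodCongr (Equiv.refl Bool)

@[simp]
theorem dartMap_mk (e : E(G.apexGraph)) (b : Bool) : D.dartMap (e, b) = (D.apexEdgeMap e, b) := rfl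

@[simp]
theorem dartMap_fst (x : Dart G.apexGraph) : (D.dartMap x).1 = D.apexEdgeMap x.1 := rfl

theorem flip_dartMap (x : Dart G.apexGraph) : flip _ (D.dartMap x) = D.dartMap (flip _ x) := rfl

theorem permCongr_flip : D.dartMap.permCongr (flip _) = flip _ := by
  ext1 y
  obtain ⟨x, rfl⟩ := D.dartMap.surjective y
  rw [Equiv.permCongr_apply, Equiv.symm_apply_apply, flip_dartMap]

open Classical in
/-- The end of a dart of `G'_v`, the darts being identified with those of `G_v`. -/
noncomputable def dualTail (x : Dart G.apexGraph) : Option α' :=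
  if D.R.tail x = none then none else some (D.faceEquiv (D.R.face x))

theorem dualTail_of_none {x : Dart G.apexGraph} (hx : D.R.tail x = none) : D.dualTail x = none :=
  if_pos hx

theorem dualTail_of_ne {x : Dart G.apexGraph} (hx : D.R.tail x ≠ none) :
    D.dualTail x = some (D.faceEquiv (D.R.face x)).1 :=
  if_neg hx

@[simp]
theorem dualTail_eq_none_iff {x : Dart G.apexGraph} : D.dualTail x = none ↔ D.R.tail x = none := by
  by_cases hx : D.R.tail x = none
  · simp [D.dualTail_of_none hx, hx]
  · simp [D.dualTail_of_ne hx, hx]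

theorem isLink_dualTail (x : Dart G.apexGraph) :
    G'.apexGraph.IsLink (D.apexEdgeMap x.1) (D.dualTail x) (D.dualTail (flip _ x)) := by
  have key : ∀ i, G'.apexGraph.IsLink (D.apexEdgeMap (G.apexEdge i)) (D.dualTail (apexDart D.R i))
      (D.dualTail (flip _ (apexDart D.R i))) := fun i => by
    rw [D.dualTail_of_none (by simp), D.dualTail_of_ne (by simp), D.faceEquiv_apexDart,
      apexEdgeMap_apexEdge]
    exact G'.apexGraph_isLink_inr.2 rfl
  refine dart_cases (P := fun x => G'.apexGraph.IsLink (D.apexEdgeMap x.1) (D.dualTail x)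
    (D.dualTail (flip _ x))) D.R (fun x e hx => ?_) (fun i => ?_) (fun i => ?_) x
  · obtain ⟨a, b, -, h1, h2⟩ := exists_tail_innerEdge D.R x hx
    rw [D.dualTail_of_ne (by simp [h1]), D.dualTail_of_ne (by simp [h2]), hx, apexEdgeMap_innerEdge]
    exact G'.apexGraph_isLink_inl.2 ⟨_, _, D.isLink_face x hx, rfl, rfl⟩
  · rw [apexDart_fst]
    exact key i
  · rw [flip_flip, flip_fst, apexDart_fst]
    exact (key i).symm

/-- The rotation of `G'_v` on the darts of `G_v`. -/
noncomputable def dualRot : Equiv.Perm (Dart G.apexGraph) := (isIndependent_apex D.R).starTriangle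

theorem dualRot_of_none {x : Dart G.apexGraph} (hx : D.R.tail x = none) :
    D.dualRot x = D.R.rot.symm x :=
  (isIndependent_apex D.R).starTriangle_of_mem hx

theorem dualTail_eq_iff (x y : Dart G.apexGraph) :
    D.dualTail x = D.dualTail y ↔ D.dualRot.SameCycle x y := by
  have hind := isIndependent_apex D.R
  by_cases hx : D.R.tail x = none <;> by_cases hy : D.R.tail y = none
  · rw [D.dualTail_of_none hx, D.dualTail_of_none hy]
    exact iff_of_true rfl
      (hind.sameCycle_starTriangle_of_mem (sameCycle_of_tail_eq_none D.R) hx hy)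
  · refine iff_of_false (fun h => hy ?_) fun h => hy ?_
    · rwa [D.dualTail_of_none hx, eq_comm, dualTail_eq_none_iff] at h
    · exact (rel_of_sameCycle (Setoid.ker fun x => x ∈ {x | D.R.tail x = none})
        (fun x => propext (hind.starTriangle_mem x).symm) h).mp hx
  · refine iff_of_false (fun h => hx ?_) fun h => hx ?_
    · rwa [D.dualTail_of_none hy, dualTail_eq_none_iff] at h
    · exact (rel_of_sameCycle (Setoid.ker fun x => x ∈ {x | D.R.tail x = none})
        (fun x => propext (hind.starTriangle_mem x).symm) h).mpr hy
  · rw [D.dualTail_of_ne hx, D.dualTail_of_ne hy, Option.some_inj, Subtype.val_inj,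
      D.faceEquiv.injective.eq_iff, D.R.face_eq_iff]
    exact (hind.sameCycle_starTriangle_iff hx hy).symm

/-- The embedding of `G'_v` obtained from the dual of the embedding of `G_v` by replacing the
triangle dual to the star at the extra vertex by a star. -/
noncomputable def dualEmbedding : RotationSystem G'.apexGraph where
  tail y := D.dualTail (D.dartMap.symm y)
  isLink e := by
    obtain ⟨e, rfl⟩ := D.apexEdgeMap.surjective e
    rw [← dartMap_mk, ← dartMap_mk, Equiv.symm_apply_apply, Equiv.symm_apply_apply]
    exact D.isLink_dualTail (e, false)
  rot := D.dartMap.permCongr D.dualRot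
  tail_eq_iff x y := by
    obtain ⟨x, rfl⟩ := D.dartMap.surjective x
    obtain ⟨y, rfl⟩ := D.dartMap.surjective y
    rw [Equiv.symm_apply_apply, Equiv.symm_apply_apply, D.dualTail_eq_iff, sameCycle_permCongr_iff]

@[simp]
theorem dualEmbedding_tail (x : Dart G.apexGraph) :
    D.dualEmbedding.tail (D.dartMap x) = D.dualTail x :=
  congrArg D.dualTail (D.dartMap.symm_apply_apply x)

theorem dualEmbedding_rot (x : Dart G.apexGraph) :
    D.dualEmbedding.rot (D.dartMap x) = D.dartMap (D.dualRot x) :=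
  congrArg (fun x => D.dartMap (D.dualRot x)) (D.dartMap.symm_apply_apply x)

theorem dualEmbedding_facePerm :
    D.dualEmbedding.rot * flip _ = D.dartMap.permCongr (D.dualRot * flip _) := by
  ext1 y
  obtain ⟨x, rfl⟩ := D.dartMap.surjective y
  simp only [Equiv.Perm.mul_apply, Equiv.permCongr_apply, Equiv.symm_apply_apply, flip_dartMap,
    dualEmbedding_rot]

theorem dualEmbedding_face_eq_iff {x y : Dart G.apexGraph} (hx : D.R.tail x ≠ none)
    (hy : D.R.tail y ≠ none) :
    D.dualEmbedding.face (D.dartMap x) = D.dualEmbedding.face (D.dartMap y) ↔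
      D.R.tail x = D.R.tail y := by
  rw [RotationSystem.face_eq_iff, dualEmbedding_facePerm, sameCycle_permCongr_iff,
    D.R.tail_eq_iff]
  exact ((isIndependent_apex D.R).sameCycle_starTriangle_mul_iff hx hy).symm

theorem dualEmbedding_jointlyTransitive (hc : Connected G.apexGraph) :
    JointlyTransitive D.dualEmbedding.rot (flip _) := by
  rw [← D.permCongr_flip]
  exact ((isIndependent_apex D.R).jointlyTransitive_starTriangle (sameCycle_of_tail_eq_none D.R)
    (D.R.jointlyTransitive_of_connected hc)).permCongr D.dartMap

/-- Vertices and faces are exchanged up to the extra vertex on either side: `V' = F + 1`, `V = F' +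
1`. There are as many edges as before, and one component. -/
theorem dualEmbedding_isPlanar (hc : Connected G.apexGraph) (hR : D.R.IsPlanar) :
    D.dualEmbedding.IsPlanar := by
  have hind := isIndependent_apex D.R
  have hA := sameCycle_of_tail_eq_none D.R
  have h1 : Nat.card D.dualEmbedding.VertexCycle = Nat.card D.R.Face + 1 :=
    (card_cycles_permCongr D.dartMap D.dualRot).trans
      (hind.card_cycles_starTriangle (apex_nonempty D.R) hA)
  have h2 : Nat.card D.R.VertexCycle = Nat.card D.dualEmbedding.Face + 1 := by
    have h3 := card_cycles_permCongr D.dartMap (D.dualRot * flip _)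
    rw [← dualEmbedding_facePerm] at h3
    exact (hind.card_cycles_eq_starTriangle_mul (apex_nonempty D.R) hA).trans
      (congrArg (· + 1) h3.symm)
  have h4 : Nat.card E(G.apexGraph) = Nat.card E(G'.apexGraph) := Nat.card_congr D.apexEdgeMap
  have h5 := D.R.card_component (D.R.jointlyTransitive_of_connected hc)
  have h6 := D.dualEmbedding.card_component (D.dualEmbedding_jointlyTransitive hc)
  unfold RotationSystem.IsPlanar at hR ⊢
  omega

theorem exists_dart_of_face (F : D.R.Face) : ∃ x, D.R.tail x ≠ none ∧ D.R.face x = F := by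
  obtain ⟨x, rfl⟩ := D.R.face_surjective F
  by_cases hx : D.R.tail x = none
  · refine ⟨D.R.rot (flip _ x), ?_, D.R.face_rot_flip x⟩
    rw [D.R.tail_rot]
    exact (isIndependent_apex D.R).flip_notMem x hx
  · exact ⟨x, hx, rfl⟩

theorem connected_apexGraph (D : DualEmbedding G G') (hc : Connected G.apexGraph) :
    Connected G'.apexGraph := by
  refine D.dualEmbedding.connected_of_jointlyTransitive (D.dualEmbedding_jointlyTransitive hc)
    ⟨none, G'.none_mem⟩ ?_
  rintro (_ | w) hw
  · exact ⟨D.dartMap (apexDart D.R 0), by simp⟩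
  · obtain ⟨x, hx, hF⟩ := D.exists_dart_of_face (D.faceEquiv.symm ⟨w, G'.some_mem_iff.1 hw⟩)
    exact ⟨D.dartMap x, by simp [D.dualTail_of_ne hx, hF]⟩

/-- The vertices of `G` are the faces of the embedding of `G'_v`. -/
theorem exists_vertexEquiv (hc : Connected G.apexGraph) :
    ∃ g : V(G.graph) ≃ D.dualEmbedding.Face,
      ∀ w x, D.R.tail x = some w.1 → g w = D.dualEmbedding.face (D.dartMap x) := by
  choose x hx using fun w : V(G.graph) => exists_tail_eq_some D.R hc w.2
  have hspec : ∀ (w : V(G.graph)) y, D.R.tail y = some w.1 →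
      D.dualEmbedding.face (D.dartMap (x w)) = D.dualEmbedding.face (D.dartMap y) := fun w y hy =>
    (D.dualEmbedding_face_eq_iff (by simp [hx]) (by simp [hy])).2 ((hx w).trans hy.symm)
  refine ⟨Equiv.ofBijective (fun w => D.dualEmbedding.face (D.dartMap (x w))) ⟨fun w w' h => ?_,
    fun F => ?_⟩, hspec⟩
  · rw [D.dualEmbedding_face_eq_iff (by simp [hx]) (by simp [hx]), hx, hx] at h
    exact Subtype.ext (Option.some_inj.1 h)
  · obtain ⟨y, rfl⟩ := D.dualEmbedding.face_surjective F
    obtain ⟨y, rfl⟩ := D.dartMap.surjective y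
    have key : ∀ y, D.R.tail y ≠ none → ∃ w, D.dualEmbedding.face (D.dartMap (x w)) =
        D.dualEmbedding.face (D.dartMap y) := fun y hy => by
      obtain ⟨w, hw⟩ := Option.ne_none_iff_exists'.1 hy
      have hmem := (D.R.isLink_dart y).left_mem
      rw [hw, some_mem_iff] at hmem
      exact ⟨⟨w, hmem⟩, hspec ⟨w, hmem⟩ y hw⟩
    -- A dart at the extra vertex is replaced by the next one along its face, which leaves a vertex
    -- of `G'`.
    by_cases hy : D.R.tail y = none
    · have hind := isIndependent_apex D.R
      obtain ⟨w, hw⟩ := key (D.dualRot (flip _ y)) fun h =>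
        hind.flip_notMem y hy ((hind.starTriangle_mem _).1 h)
      refine ⟨w, hw.trans ?_⟩
      rw [← dualEmbedding_rot, ← flip_dartMap, RotationSystem.face_rot_flip]
    · exact key y hy

theorem isDual {d : ℝ} (hc : Connected G.apexGraph) (hR : D.R.IsPlanar)
    (hw : ∀ e, (d - 2) / 2 * G.weight e + (d - 2) / 2 * G'.weight (D.edgeMap e) = d / 2) :
    IsDual d G' G := by
  obtain ⟨g, hg⟩ := D.exists_vertexEquiv hc
  refine ⟨D.dualEmbedding, D.dualEmbedding_isPlanar hc hR, g.symm, D.edgeMap.symm, ?_, ?_, ?_⟩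
  · intro e F F'
    obtain ⟨e, rfl⟩ := D.edgeMap.surjective e
    obtain ⟨w, rfl⟩ := g.surjective F
    obtain ⟨w', rfl⟩ := g.surjective F'
    obtain ⟨a, b, h, ha, hb⟩ := exists_tail_innerEdge D.R (G.innerEdge e, false) rfl
    rw [Equiv.symm_apply_apply, Equiv.symm_apply_apply, Equiv.symm_apply_apply,
      h.isLink_iff_sym2_eq, ← apexEdgeMap_innerEdge]
    change s(g w, g w') = s(D.dualEmbedding.face (D.dartMap (G.innerEdge e, false)),
      D.dualEmbedding.face (D.dartMap (flip _ (G.innerEdge e, false)))) ↔ _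
    rw [← hg ⟨a, h.left_mem⟩ _ ha, ← hg ⟨b, h.right_mem⟩ _ hb]
    simp only [Sym2.eq_iff, g.injective.eq_iff, Subtype.ext_iff]
    grind
  · intro i y hy h1 h2
    obtain ⟨x, rfl⟩ := D.dartMap.surjective y
    rw [dualEmbedding_tail, dualTail_eq_none_iff, tail_eq_none_iff] at hy
    obtain ⟨j, rfl⟩ := hy
    -- The orientation at the extra vertex is reversed. The corner lies between the labels `τ⁻¹ j`
    -- and `τ⁻² j` of `G'`, so the remaining label is `j`.
    have hrot : D.dualRot (apexDart D.R j) = apexDart D.R (D.τ.symm j) := by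
      rw [D.dualRot_of_none (tail_apexDart D.R j), Equiv.symm_apply_eq,
        D.rot_apexDart, Equiv.apply_symm_apply]
    have hτ : ∀ {k l}, G'.apexEdge k ≠ G'.apexEdge l → l ≠ k := fun h h' => h (by rw [h'])
    rw [dualEmbedding_rot, hrot] at h2 ⊢
    rw [dartMap_fst, apexDart_fst, apexEdgeMap_apexEdge] at h1 h2
    have hij : i = j := by
      have hne : ∀ k, D.τ.symm k ≠ k := fun k hk => D.τ_ne k ((Equiv.symm_apply_eq _).1 hk).symm
      simpa using (Equiv.symm_apply_eq _).1 (apply_eq_of_ne hne (hτ h1) (hτ h2))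
    subst hij
    have hF : D.dualEmbedding.face (D.dartMap (apexDart D.R (D.τ.symm i))) =
        D.dualEmbedding.face (D.dartMap (flip _ (apexDart D.R i))) := by
      rw [← hrot, ← dualEmbedding_rot, ← D.dualEmbedding.face_rot_flip (D.dartMap (flip _ _)),
        flip_dartMap, flip_flip]
    rw [hF, ← hg ⟨G.ext i, G.ext_mem i⟩ _ (tail_flip_apexDart D.R i), Equiv.symm_apply_apply]
  · intro e
    obtain ⟨e, rfl⟩ := D.edgeMap.surjective e
    rw [Equiv.symm_apply_apply, add_comm]
    exact hw e

/-- The dual of `G_v` is connected, so it suffices to bypass the three deleted edges. The faces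
around the `i`-th external vertex are consecutively joined by duals of edges of `G`, except across
its edge to `v`; going the other way round joins the two sides of that edge too. -/
theorem connected_graph (D : DualEmbedding G G') (hc : Connected G.apexGraph)
    (hinj : Function.Injective G.ext) :
    Connected G'.graph := by
  refine ⟨⟨G'.ext 0, G'.ext_mem 0⟩, fun u hu w hw => ?_⟩
  have : Std.Symm G'.graph.Adj := ⟨fun _ _ h => h.symm⟩
  have hsymm := Relation.ReflTransGen.stdSymm (r := G'.graph.Adj)
  let r : Setoid (Dart G.apexGraph) :=
    ⟨fun x y => Relation.ReflTransGen G'.graph.Adj (D.faceEquiv (D.R.face x))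
        (D.faceEquiv (D.R.face y)),
      ⟨fun _ => .refl, fun h => hsymm.symm _ _ h, fun h h' => h.trans h'⟩⟩
  have hinner : ∀ (x : Dart G.apexGraph) e, x.1 = G.innerEdge e → r x (flip _ x) := fun x e hx =>
    .single (D.isLink_face x hx).adj
  have hrot : ∀ x, r (flip _ x) (D.R.rot x) := fun x => by
    change Relation.ReflTransGen _ _ _
    rw [D.R.face_flip]
  have hapex : ∀ i, r (flip _ (apexDart D.R i)) (apexDart D.R i) := by
    intro i
    set b := flip _ (apexDart D.R i) with hb
    -- the darts at the `i`-th external vertex other than `b` belong to edges of `G`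
    have hstep : ∀ x, D.R.tail x = D.R.tail b → x ≠ b → r x (D.R.rot x) := by
      intro x
      refine dart_cases (P := fun x => D.R.tail x = D.R.tail b → x ≠ b → r x (D.R.rot x)) D.R
        (fun x e hx _ _ => r.trans (hinner x e hx) (hrot x)) (fun j h => ?_) (fun j h hne => ?_) x
      · simp [hb] at h
      · rw [hb, tail_flip_apexDart, tail_flip_apexDart, Option.some_inj, hinj.eq_iff] at h
        exact absurd (by rw [h]) hne
    -- The walk around the vertex must stop at its first return to `b`, since `hstep` does not apply
    -- there.
    have hind : ∀ n : ℕ, r (D.R.rot b) ((D.R.rot ^ (n + 1)) b) ∨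
        ∃ m ≤ n, (D.R.rot ^ (m + 1)) b = b ∧ r (D.R.rot b) b := by
      intro n
      induction n with
      | zero => exact Or.inl (r.refl _)
      | succ n ih =>
        rcases ih with h | ⟨m, hm, h⟩
        · by_cases hfix : (D.R.rot ^ (n + 1)) b = b
          · exact Or.inr ⟨n, by omega, hfix, by rwa [hfix] at h⟩
          · left
            refine r.trans h ?_
            rw [pow_succ' _ (n + 1), Equiv.Perm.mul_apply]
            refine hstep _ ?_ hfix
            rw [D.R.tail_eq_iff, Equiv.Perm.sameCycle_pow_left]
        · exact Or.inr ⟨m, by omega, h⟩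
    have hloop : r (D.R.rot b) b := by
      rcases hind (orderOf D.R.rot - 1) with h | ⟨-, -, -, h⟩
      · rwa [Nat.sub_add_cancel (isOfFinOrder_of_finite D.R.rot).orderOf_pos, pow_orderOf_eq_one,
          Equiv.Perm.one_apply] at h
      · exact h
    refine r.symm ?_
    have := hrot b
    rw [hb, flip_flip, ← hb] at this
    exact r.trans this hloop
  have hflip : ∀ x, r x (flip _ x) := dart_cases (P := fun x => r x (flip _ x)) D.R hinner
    (fun i => r.symm (hapex i)) (fun i => by rw [flip_flip]; exact hapex i)
  have hall := D.R.jointlyTransitive_of_connected hc r (fun x => r.trans (hflip x) (hrot x)) hflip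
  obtain ⟨x, hx⟩ := D.R.face_surjective (D.faceEquiv.symm ⟨u, hu⟩)
  obtain ⟨y, hy⟩ := D.R.face_surjective (D.faceEquiv.symm ⟨w, hw⟩)
  have h : Relation.ReflTransGen G'.graph.Adj _ _ := hall x y
  simpa [hx, hy] using h

/-- The labels `τ⁻¹ i` and `τ⁻² i` sit on the two sides of the `i`-th edge at `v`. If they coincide,
a potential jumps across this edge only. But it is constant along a path in `G` from the `i`-th to
the `τ i`-th external vertex and on along the edge to `v`, a contradiction. -/
theorem ext_injective (hc : Connected G.apexGraph) (hR : D.R.IsPlanar)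
    (hG : Connected G.graph) :
    Function.Injective G'.ext := by
  have := G.finite_edges
  have := Fintype.ofFinite E(G.apexGraph)
  have key : ∀ i, G'.ext (D.τ.symm i) ≠ G'.ext (D.τ.symm (D.τ.symm i)) := by
    intro i h
    have hface : D.R.face (apexDart D.R i) = D.R.face (flip _ (apexDart D.R i)) := by
      rw [← D.faceEquiv_apexDart, ← D.faceEquiv_apexDart, Subtype.val_inj,
        D.faceEquiv.injective.eq_iff, D.R.face_flip (apexDart D.R (D.τ.symm i)), D.rot_apexDart,
        Equiv.apply_symm_apply] at h
      exact h.symm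
    obtain ⟨p, htail, hedge, hjump⟩ :=
      D.R.exists_potential (D.R.jointlyTransitive_of_connected hc) hR hface
    rw [apexDart_fst] at hedge
    have hconst : ∀ w, Relation.ReflTransGen G.graph.Adj (G.ext i) w →
        ∀ x, D.R.tail x = some w → p (flip _ (apexDart D.R i)) = p x := by
      intro w hw
      induction hw with
      | refl => exact fun x hx => htail _ _ (by rw [tail_flip_apexDart, hx])
      | tail _ hadj ih =>
        intro x hx
        obtain ⟨e, he⟩ := hadj
        obtain ⟨z, hz, hz1, hz2⟩ := D.R.exists_tail_eq (G.apexGraph_isLink_inl.2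
          ⟨_, _, he, rfl, rfl⟩)
        have hne : z.1 ≠ G.apexEdge i := fun h0 =>
          Sum.inl_ne_inr (hz.symm.trans (congrArg Subtype.val h0))
        rw [ih z hz1, ← hedge z hne]
        exact htail _ _ (hz2.trans hx.symm)
    have h1 := hconst _ (hG.2 _ (G.ext_mem i) _ (G.ext_mem (D.τ i))) _
      (tail_flip_apexDart D.R (D.τ i))
    have h2 : (apexDart D.R (D.τ i)).1 ≠ G.apexEdge i := by
      rw [apexDart_fst]
      exact fun h0 => D.τ_ne i (G.apexEdge_injective h0)
    exact hjump (h1.trans ((hedge _ h2).trans (htail _ _ (by simp))))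
  have key' : ∀ i, G'.ext i ≠ G'.ext (D.τ.symm i) := fun i => by
    simpa using key (D.τ i)
  intro i j hij
  by_contra hne
  -- In a 3-cycle, distinct labels are neighbours in one direction or the other.
  by_cases h : i = D.τ j
  · exact key' i (by rw [hij, h, Equiv.symm_apply_apply])
  · have := apply_eq_of_ne D.τ_ne hne h
    exact key' j (by rw [← hij, ← this, Equiv.symm_apply_apply])

end DualEmbedding

end FeynmanGraph

end FeynmanDual

theorem lemma4p2 {α β α' β' : Type*} (d : ℝ) (hd : 2 < d)
    (G : FeynmanDual.FeynmanGraph α β) (G' : FeynmanDual.FeynmanGraph α' β')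
    (hconn : FeynmanDual.Connected G.apexGraph)
    (hG : G.ExternallyPlanar)
    (hdual : FeynmanDual.FeynmanGraph.IsDual d G G') :
    G'.ExternallyPlanar ∧
    FeynmanDual.FeynmanGraph.IsDual d G' G ∧
    FeynmanDual.Connected G'.apexGraph ∧
    (FeynmanDual.Connected G.graph → Function.Injective G.ext →
      FeynmanDual.Connected G'.graph ∧ Function.Injective G'.ext) := by
  obtain ⟨R, hR, f, ε, hlink, hlabel, hw⟩ := hdual
  obtain ⟨τ, hrot, hτ⟩ := FeynmanDual.FeynmanGraph.exists_perm_labels R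
  have hτ' : ∀ i, i ≠ τ.symm i := fun i h => hτ i ((Equiv.eq_symm_apply _).1 h)
  have hτ'' : ∀ i, τ i ≠ τ.symm i := fun i h =>
    FeynmanDual.apply_apply_ne hτ i ((Equiv.eq_symm_apply _).1 h)
  -- This face is the corner between the `i`-th and the `τ i`-th edge, so it carries the third label
  -- `τ⁻¹ i`.
  have hface : ∀ i, (f (R.face (FeynmanDual.flip _ (FeynmanDual.FeynmanGraph.apexDart R i))) : α') =
      G'.ext (τ.symm i) := fun i => by
    rw [R.face_flip]
    refine hlabel _ _ (FeynmanDual.FeynmanGraph.tail_apexDart R i) ?_ ?_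
    · rw [FeynmanDual.FeynmanGraph.apexDart_fst]
      exact fun h => hτ' i (G.apexEdge_injective h)
    · rw [hrot, FeynmanDual.FeynmanGraph.apexDart_fst]
      exact fun h => hτ'' i (G.apexEdge_injective h)
  let D : FeynmanDual.FeynmanGraph.DualEmbedding G G' := ⟨R, f, ε, hlink, τ, hrot, hτ, hface⟩
  exact ⟨⟨D.dualEmbedding, D.dualEmbedding_isPlanar hconn hR⟩, D.isDual hconn hR hw,
    D.connected_apexGraph hconn, fun hGc hinj =>
      ⟨D.connected_graph hconn hinj, D.ext_injective hconn hR hGc⟩⟩
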